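/- Let $X$ be a countable set and let $b$ be a graph over $X$, i.e. a map $b:X\times X\to[0,\infty)$ that is symmetric, vanishes on the diagonal and satisfies $\sum_{y\in X}b(x,y)<\infty$ for every $x\in X$ (neither connectedness nor local finiteness is assumed). For $f:X\to\mathbb R$ put $$Q(f)=\frac12\sum_{x,y\in X}b(x,y)\,(f(x)-f(y))^2\in[0,\infty],$$ and let $R:X\times X\to[0,\infty]$ be the resistance metric $$R(x,y)=\sup_{f:X\to\mathbb R}\frac{(f(y)-f(x))^2}{Q(f)},$$ with the conventions $c/0=\infty$ for $c>0$, $0/0=0$ and $c/\infty=0$ for $0\le c<\infty$. A path from $x$ to $z$ is a finite sequence $(x_0,\dots,x_n)$, $n\ge 0$, of pairwise distinct vertices with $x_0=x$, $x_n=z$ and $b(x_{i-1},x_i)>0$ for $i=1,\dots,n$; it passes through $y$ if $y=x_i$ for some $i\in\{0,\dots,n\}$. Let $x,y,z\in X$. Then the following are equivalent: (i) $R(x,z)=R(x,y)+R(y,z)$ (as an equality in $[0,\infty]$). (ii) Every path from $x$ to $z$ passes through $y$. -/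

import Mathlib

open scoped NNReal ENNReal

/-- A (weighted) graph over a set `X`: a symmetric map `b : X × X → [0, ∞)` that vanishes on
the diagonal and satisfies `∑ y, b x y < ∞` for every vertex `x`. -/
structure GraphOver (X : Type*) where
  b : X → X → ℝ≥0
  symm : ∀ x y, b x y = b y x
  diag : ∀ x, b x x = 0
  summable : ∀ x, Summable (fun y => b x y)

namespace GraphOver

variable {X : Type*} (G : GraphOver X)

/-- The underlying combinatorial graph: `x` and `y` are adjacent iff `b x y > 0`. -/
def toSimpleGraph : SimpleGraph X where
  Adj x y := 0 < G.b x y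
  symm := ⟨fun x y h => by rw [G.symm y x]; exact h⟩
  loopless := ⟨fun x h => by rw [G.diag x] at h; exact lt_irrefl _ h⟩

/-- The energy `Q f = (1/2) ∑_{x,y} b x y (f x - f y)²`, with values in `[0, ∞]`. -/
noncomputable def energy (f : X → ℝ) : ℝ≥0∞ :=
  (1 / 2) * ∑' (x : X) (y : X), (G.b x y : ℝ≥0∞) * ENNReal.ofReal ((f x - f y) ^ 2)

/-- The resistance metric `R x y = sup_f (f y - f x)² / Q f`, with values in `[0, ∞]`, the
supremum being over all functions `f : X → ℝ`. In `ℝ≥0∞` the quotient obeys the conventions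
`c / 0 = ∞` for `c > 0`, `0 / 0 = 0` and `c / ∞ = 0` for finite `c`. -/
noncomputable def resistance (x y : X) : ℝ≥0∞ :=
  ⨆ f : X → ℝ, ENNReal.ofReal ((f y - f x) ^ 2) / G.energy f

end GraphOver

/-! For `x`, `y` connected, Riesz representation on the `ℓ²` gradients gives a dipole potential `h`,
and Cauchy–Schwarz gives `R(x,y) = h x - h y`. If `g` is a dipole potential for `y`, `z`, then `h +
g` is one for `x`, `z`; symmetry of the inner product gives `g x - g y = h y - h z`, so `R(x,y) +
R(y,z) - R(x,z) = 2 (h z - h y)`. Thus (i) means `h z = h y`. On its component `h` is minimal at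
`y`. If also `h z = h y`, harmonicity carries this value along any walk from `z` avoiding `y`, so
such a walk cannot reach `x`. If `y` separates `x` from `z`, a cutoff of `h` shows that `h` is
constant beyond `y`. Across components resistance is infinite. -/

open scoped InnerProductSpace

namespace GraphOver

variable {X : Type*} (G : GraphOver X)

/-- The square-summable functions on pairs of vertices. -/
abbrev PairL2 (X : Type*) := lp (fun _ : X × X => ℝ) 2

/-- The weighted discrete gradient, normalized so that its `ℓ²` norm squared is the energy. -/
noncomputable def grad (f : X → ℝ) (e : X × X) : ℝ :=
  √((G.b e.1 e.2 : ℝ) / 2) * (f e.1 - f e.2)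

lemma grad_mul_grad (f g : X → ℝ) (e : X × X) :
    G.grad f e * G.grad g e =
      (G.b e.1 e.2 : ℝ) / 2 * ((f e.1 - f e.2) * (g e.1 - g e.2)) := by
  have h : √((G.b e.1 e.2 : ℝ) / 2) * √((G.b e.1 e.2 : ℝ) / 2) = (G.b e.1 e.2 : ℝ) / 2 :=
    Real.mul_self_sqrt (by positivity)
  unfold grad
  linear_combination ((f e.1 - f e.2) * (g e.1 - g e.2)) * h

lemma grad_add (f g : X → ℝ) : G.grad (f + g) = G.grad f + G.grad g := by
  funext e
  simp only [grad, Pi.add_apply]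
  ring

lemma grad_smul (c : ℝ) (f : X → ℝ) : G.grad (c • f) = c • G.grad f := by
  funext e
  simp only [grad, Pi.smul_apply, smul_eq_mul]
  ring

lemma grad_zero : G.grad 0 = 0 := by
  funext e
  simp [grad]

lemma grad_eq_zero_of_not_adj (f : X → ℝ) {e : X × X} (h : ¬ G.toSimpleGraph.Adj e.1 e.2) :
    G.grad f e = 0 := by
  have : G.b e.1 e.2 = 0 := by simpa [toSimpleGraph] using h
  simp [grad, this]

lemma energy_eq_tsum (f : X → ℝ) :
    G.energy f = ∑' e : X × X, ENNReal.ofReal (G.grad f e ^ 2) := by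
  rw [energy, ← ENNReal.tsum_prod (f := fun x y => (G.b x y : ℝ≥0∞) *
    ENNReal.ofReal ((f x - f y) ^ 2)), ← ENNReal.tsum_mul_left]
  refine tsum_congr fun e => ?_
  have h : G.grad f e ^ 2 = (1 / 2) * ((G.b e.1 e.2 : ℝ) * (f e.1 - f e.2) ^ 2) := by
    rw [pow_two, grad_mul_grad]
    ring
  rw [h, ENNReal.ofReal_mul (by norm_num), ENNReal.ofReal_mul (by positivity),
    ENNReal.ofReal_coe_nnreal, ENNReal.ofReal_div_of_pos (by norm_num)]
  simp

lemma memℓp_two_iff {ι : Type*} {u : ι → ℝ} : Memℓp u 2 ↔ Summable fun i => u i ^ 2 := by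
  rw [memℓp_gen_iff (by norm_num)]
  simp

lemma energy_eq_top {f : X → ℝ} (h : ¬ Memℓp (G.grad f) 2) : G.energy f = ⊤ := by
  by_contra hne
  refine h (memℓp_two_iff.2 ?_)
  rw [energy_eq_tsum] at hne
  refine (ENNReal.summable_toReal hne).congr fun e => ?_
  exact (ENNReal.toReal_ofReal (sq_nonneg _))

lemma hasSum_inner_pairL2 (u v : PairL2 X) : HasSum (fun e => u e * v e) ⟪u, v⟫_ℝ := by
  simpa [mul_comm] using lp.hasSum_inner (𝕜 := ℝ) u v

lemma energy_eq_norm_sq {f : X → ℝ} (u : PairL2 X) (hu : ⇑u = G.grad f) :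
    G.energy f = ENNReal.ofReal (‖u‖ ^ 2) := by
  have h := hasSum_inner_pairL2 u u
  rw [real_inner_self_eq_norm_sq] at h
  rw [energy_eq_tsum, ← h.tsum_eq, ENNReal.ofReal_tsum_of_nonneg
    (fun e => mul_self_nonneg _) h.summable, hu]
  simp only [pow_two]

/-- The space of gradients of functions of finite energy. -/
noncomputable def gradientSpace : Submodule ℝ (PairL2 X) where
  carrier := {u | ∃ f, ⇑u = G.grad f}
  add_mem' := by
    rintro u v ⟨f, hf⟩ ⟨g, hg⟩
    exact ⟨f + g, by rw [lp.coeFn_add, hf, hg, grad_add]⟩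
  zero_mem' := ⟨0, by rw [lp.coeFn_zero, grad_zero]⟩
  smul_mem' := by
    rintro c u ⟨f, hf⟩
    exact ⟨c • f, by rw [lp.coeFn_smul, hf, grad_smul]⟩

/-- Along a walk, the difference of the values of `f` is a continuous function of its gradient. -/
lemma exists_continuousLinearMap_sub {x y : X} (h : G.toSimpleGraph.Reachable x y) :
    ∃ L : PairL2 X →L[ℝ] ℝ, ∀ (u : PairL2 X) (f : X → ℝ), ⇑u = G.grad f → L u = f x - f y := by
  obtain ⟨p⟩ := h
  induction p with
  | nil => exact ⟨0, fun u f _ => by simp⟩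
  | @cons a b c hab p ih =>
    obtain ⟨L, hL⟩ := ih
    refine ⟨L + (√((G.b a b : ℝ) / 2))⁻¹ • lp.evalCLM ℝ (fun _ : X × X => ℝ) 2 (a, b),
      fun u f hu => ?_⟩
    have hpos : 0 < √((G.b a b : ℝ) / 2) := Real.sqrt_pos.2 (half_pos (NNReal.coe_pos.2 hab))
    have he : lp.evalCLM ℝ (fun _ : X × X => ℝ) 2 (a, b) u = G.grad f (a, b) := congrFun hu _
    rw [add_apply, smul_apply, hL u f hu, he, grad,
      smul_eq_mul, inv_mul_cancel_left₀ hpos.ne']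
    ring

/-- Integrating `u` from a base point of each component recovers its potential continuously, so
being a gradient is a closed condition on each pair. Closedness gives the completeness that Riesz
needs. -/
lemma isClosed_gradientSpace : IsClosed (G.gradientSpace : Set (PairL2 X)) := by
  have hr : ∀ v, G.toSimpleGraph.Reachable v (G.toSimpleGraph.connectedComponentMk v).out :=
    fun v => SimpleGraph.ConnectedComponent.exact (Quot.out_eq _).symm
  choose L hL using fun v => G.exists_continuousLinearMap_sub (hr v)
  have hset : (G.gradientSpace : Set (PairL2 X)) =
      ⋂ e : X × X, {u | u e = √((G.b e.1 e.2 : ℝ) / 2) * (L e.1 u - L e.2 u)} := by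
    ext u
    simp only [Set.mem_iInter, Set.mem_ofPred_eq]
    constructor
    · rintro ⟨f, hf⟩ e
      rw [hL _ u f hf, hL _ u f hf, hf]
      by_cases hadj : G.toSimpleGraph.Adj e.1 e.2
      · rw [SimpleGraph.ConnectedComponent.sound hadj.reachable, grad]
        ring
      · have : G.b e.1 e.2 = 0 := by simpa [toSimpleGraph] using hadj
        simp [grad, this]
    · exact fun h => ⟨fun v => L v u, funext h⟩
  rw [hset]
  refine isClosed_iInter fun e => isClosed_eq ?_ (by fun_prop)
  exact (lp.evalCLM ℝ (fun _ : X × X => ℝ) 2 e).continuous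

/-- `h` is the potential of a unit current from `x` to `y`: `u` is its gradient and represents
the functional `f ↦ f x - f y` on functions of finite energy. -/
structure IsDipole (x y : X) (h : X → ℝ) (u : PairL2 X) : Prop where
  coe_eq : ⇑u = G.grad h
  inner_eq : ∀ (v : PairL2 X) (f : X → ℝ), ⇑v = G.grad f → ⟪u, v⟫_ℝ = f x - f y

lemma exists_isDipole {x y : X} (hxy : G.toSimpleGraph.Reachable x y) :
    ∃ h u, G.IsDipole x y h u := by
  obtain ⟨L, hL⟩ := G.exists_continuousLinearMap_sub hxy
  have : CompleteSpace G.gradientSpace := G.isClosed_gradientSpace.completeSpace_coe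
  obtain ⟨h, hh⟩ := ((InnerProductSpace.toDual ℝ G.gradientSpace).symm
    (L.comp G.gradientSpace.subtypeL)).2
  refine ⟨h, _, hh, fun v f hv => ?_⟩
  have := InnerProductSpace.toDual_symm_apply (𝕜 := ℝ) (E := G.gradientSpace)
    (x := ⟨v, f, hv⟩) (y := L.comp G.gradientSpace.subtypeL)
  rw [← hL v f hv]
  exact this

/-! ### Resistance and minimum principle for dipoles -/

namespace IsDipole

variable {G} {x y z : X} {h : X → ℝ} {u : PairL2 X}

lemma norm_sq (H : G.IsDipole x y h u) : ‖u‖ ^ 2 = h x - h y := by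
  rw [← real_inner_self_eq_norm_sq, H.inner_eq u h H.coe_eq]

lemma le (H : G.IsDipole x y h u) : h y ≤ h x := by
  have := H.norm_sq
  nlinarith [sq_nonneg ‖u‖]

lemma add {g : X → ℝ} {w : PairL2 X} (H : G.IsDipole x y h u) (H' : G.IsDipole y z g w) :
    G.IsDipole x z (h + g) (u + w) where
  coe_eq := by rw [lp.coeFn_add, H.coe_eq, H'.coe_eq, grad_add]
  inner_eq v f hv := by
    rw [inner_add_left, H.inner_eq v f hv, H'.inner_eq v f hv]
    ring

lemma resistance_eq (H : G.IsDipole x y h u) :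
    G.resistance x y = ENNReal.ofReal (h x - h y) := by
  rw [resistance, ← H.norm_sq]
  apply le_antisymm
  · refine iSup_le fun f => ?_
    by_cases hf : Memℓp (G.grad f) 2
    · have hv := H.inner_eq ⟨_, hf⟩ f rfl
      rw [G.energy_eq_norm_sq ⟨_, hf⟩ rfl]
      refine ENNReal.div_le_of_le_mul ?_
      rw [← ENNReal.ofReal_mul (sq_nonneg _)]
      refine ENNReal.ofReal_le_ofReal ?_
      rw [← neg_sq, neg_sub, ← hv, ← mul_pow, sq_le_sq]
      refine (abs_real_inner_le_norm _ _).trans (le_abs_self _)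
    · rw [G.energy_eq_top hf, ENNReal.div_top]
      exact zero_le
  · refine le_iSup_of_le h ?_
    rw [G.energy_eq_norm_sq u H.coe_eq]
    have hs : (h y - h x) ^ 2 = ‖u‖ ^ 2 * ‖u‖ ^ 2 := by
      rw [H.norm_sq]
      ring
    rw [hs, ENNReal.ofReal_mul (sq_nonneg _)]
    -- The supremum is attained at `h`; zero norm is separate because `0 / 0 = 0`.
    rcases eq_or_ne (ENNReal.ofReal (‖u‖ ^ 2)) 0 with h0 | h0
    · rw [h0]
      exact zero_le
    · rw [ENNReal.mul_div_cancel_right h0 ENNReal.ofReal_ne_top]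

/-- A function with the same values at the poles whose gradient is dominated by that of the
dipole is constant on connected components. -/
lemma eq_of_sq_le (H : G.IsDipole x y h u) {k : X → ℝ}
    (hk : ∀ a b, G.toSimpleGraph.Adj a b → (k a - k b) ^ 2 ≤ (h a - h b) * (k a - k b))
    (hkxy : k x = k y) {v w : X} (hvw : G.toSimpleGraph.Reachable v w) : k v = k w := by
  have hle : ∀ e, G.grad k e ^ 2 ≤ G.grad h e * G.grad k e := by
    intro e
    by_cases hadj : G.toSimpleGraph.Adj e.1 e.2
    · rw [pow_two, grad_mul_grad, grad_mul_grad]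
      have := hk _ _ hadj
      rw [pow_two] at this
      gcongr
    · simp [G.grad_eq_zero_of_not_adj k hadj]
  have hsum : Summable fun e => G.grad h e ^ 2 := by
    rw [← memℓp_two_iff, ← H.coe_eq]
    exact lp.memℓp u
  have hmem : Memℓp (G.grad k) 2 := by
    refine memℓp_two_iff.2 (hsum.of_nonneg_of_le (fun e => sq_nonneg _) fun e => ?_)
    nlinarith [hle e, sq_nonneg (G.grad h e - G.grad k e)]
  let t : PairL2 X := ⟨_, hmem⟩
  have h1 := hasSum_inner_pairL2 u t
  have h2 := hasSum_inner_pairL2 t t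
  rw [H.inner_eq t k rfl, hkxy, sub_self, H.coe_eq] at h1
  -- Equal values of `k` at the poles make the pairing with `u` vanish, and it dominates `‖t‖²`
  -- termwise.
  have h3 : ⟪t, t⟫_ℝ ≤ 0 := hasSum_le (fun e => by rw [← pow_two]; exact hle e) h2 h1
  have ht : t = 0 := inner_self_eq_zero.1 (le_antisymm h3 real_inner_self_nonneg)
  obtain ⟨L, hL⟩ := G.exists_continuousLinearMap_sub hvw
  have := hL t k rfl
  rw [ht, map_zero] at this
  linarith

lemma apply_le (H : G.IsDipole x y h u) {v : X} (hv : G.toSimpleGraph.Reachable v y) :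
    h y ≤ h v := by
  -- The part of `h` below `h y` vanishes at both poles, hence everywhere on the component.
  have key := H.eq_of_sq_le (k := fun v => min (h v - h y) 0) (fun a b _ => ?_) ?_ hv
  · simpa using key
  · rcases le_total (h a) (h y) with ha | ha <;> rcases le_total (h b) (h y) with hb | hb <;>
      simp only [min_eq_left, min_eq_right, ha, hb, sub_nonneg, sub_nonpos] <;> nlinarith
  · simpa using H.le

end IsDipole

-- Summability of `b v` makes point indicators admissible test functions; pairing with them
-- expresses harmonicity.
open Classical in
lemma memℓp_grad_single (v : X) : Memℓp (G.grad (Pi.single v 1)) 2 := by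
  rw [memℓp_two_iff]
  have hs : Summable fun w => (G.b v w : ℝ) := NNReal.summable_coe.2 (G.summable v)
  have h1 : Summable fun e : X × X => if e.1 = v then (G.b v e.2 : ℝ) else 0 := by
    rw [← (Prod.mk_right_injective v).summable_iff (fun e he => if_neg fun hev => he
      ⟨e.2, by rw [← hev]⟩)]
    simpa [Function.comp_def] using hs
  have h2 : Summable fun e : X × X => if e.2 = v then (G.b v e.1 : ℝ) else 0 := by
    rw [← (Prod.mk_left_injective v).summable_iff (fun e he => if_neg fun hev => he
      ⟨e.1, by rw [← hev]⟩)]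
    simpa [Function.comp_def] using hs
  refine (h1.add h2).of_nonneg_of_le (fun e => sq_nonneg _) fun e => ?_
  rw [pow_two, grad_mul_grad]
  obtain ⟨a, b⟩ := e
  have hb : (0 : ℝ) ≤ G.b a b := (G.b a b).2
  by_cases ha : a = v <;> by_cases hb' : b = v <;> simp [ha, hb']
  subst hb'
  rw [G.symm b a]
  linarith

/-! ### Harmonicity and separation by a vertex -/

namespace IsDipole

variable {G} {x y z : X} {h : X → ℝ} {u : PairL2 X}

lemma apply_ne (H : G.IsDipole x y h u) (hxy : x ≠ y) : h x ≠ h y := by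
  classical
  intro he
  have hn := H.norm_sq
  rw [he, sub_self, sq_eq_zero_iff, norm_eq_zero] at hn
  have := H.inner_eq ⟨_, G.memℓp_grad_single x⟩ _ rfl
  rw [hn, inner_zero_left, Pi.single_eq_same, Pi.single_eq_of_ne hxy.symm] at this
  norm_num at this

/-- A dipole potential is harmonic off its poles, so a local minimum there is shared by all
neighbours. -/
lemma eq_of_isMin (H : G.IsDipole x y h u) {v w : X} (hvx : v ≠ x) (hvy : v ≠ y)
    (hmin : ∀ a, G.toSimpleGraph.Adj v a → h v ≤ h a) (hvw : G.toSimpleGraph.Adj v w) :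
    h v = h w := by
  classical
  have hs := hasSum_inner_pairL2 u ⟨_, G.memℓp_grad_single v⟩
  rw [H.inner_eq ⟨_, G.memℓp_grad_single v⟩ _ rfl, Pi.single_eq_of_ne hvx.symm,
    Pi.single_eq_of_ne hvy.symm, sub_self, H.coe_eq] at hs
  -- At a local minimum all terms are nonpositive and sum to zero, so each vanishes.
  have hs' := hs.neg
  rw [neg_zero, hasSum_zero_iff_of_nonneg] at hs'
  · have h0 := congrFun hs' (v, w)
    simp only [Pi.zero_apply, neg_eq_zero, grad_mul_grad] at h0
    have hpos : (0 : ℝ) < G.b v w := NNReal.coe_pos.2 hvw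
    rw [Pi.single_eq_same, Pi.single_eq_of_ne hvw.ne'] at h0
    have : (G.b v w : ℝ) / 2 ≠ 0 := by positivity
    simp only [sub_zero, mul_one, mul_eq_zero, this, false_or] at h0
    linarith
  · rintro ⟨a, b⟩
    by_cases hadj : G.toSimpleGraph.Adj a b
    · simp only [grad_mul_grad]
      have hb : (0 : ℝ) ≤ (G.b a b : ℝ) / 2 := by positivity
      rw [← mul_neg]
      refine mul_nonneg hb ?_
      by_cases ha : a = v
      · subst ha
        rw [Pi.single_eq_same, Pi.single_eq_of_ne hadj.ne']
        linarith [hmin b hadj]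
      · by_cases hb' : b = v
        · subst hb'
          rw [Pi.single_eq_same, Pi.single_eq_of_ne ha]
          linarith [hmin a hadj.symm]
        · simp [Pi.single_eq_of_ne ha, Pi.single_eq_of_ne hb']
    · simp [G.grad_eq_zero_of_not_adj h (e := (a, b)) hadj]

/-- The minimum propagates backwards from `z`. The first alternative absorbs walks meeting `x`,
where `h` is not harmonic. -/
lemma eq_or_eq_of_walk (H : G.IsDipole x y h u) {a z : X} (p : G.toSimpleGraph.Walk a z)
    (hp : y ∉ p.support) (hz : G.toSimpleGraph.Reachable z y) (hzy : h z = h y) :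
    h x = h y ∨ h a = h y := by
  induction p with
  | nil => exact Or.inr hzy
  | @cons a b c hab p ih =>
    rw [SimpleGraph.Walk.support_cons, List.mem_cons, not_or] at hp
    rcases ih hp.2 hz hzy with hx | hb
    · exact Or.inl hx
    · by_cases hbx : b = x
      · exact Or.inl (hbx ▸ hb)
      · refine Or.inr ?_
        have hby : b ≠ y := fun e => hp.2 (e ▸ p.start_mem_support)
        rw [← H.eq_of_isMin hbx hby (fun w hw => ?_) hab.symm, hb]
        rw [hb]
        exact H.apply_le (hw.symm.reachable.trans (p.reachable.trans hz))

lemma eq_iff_forall_walk (H : G.IsDipole x y h u) (hz : G.toSimpleGraph.Reachable z y) :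
    h z = h y ↔ ∀ p : G.toSimpleGraph.Walk x z, y ∈ p.support := by
  classical
  constructor
  · intro hzy p
    by_contra hp
    have hxy : x ≠ y := fun e => hp (e ▸ p.start_mem_support)
    exact H.apply_ne hxy ((or_self_iff).1 (H.eq_or_eq_of_walk p hp hz hzy))
  · intro hp
    -- `C` is the component of `z` after deleting `y`. Its edges leave only to `y`, where `h v - h
    -- y` vanishes, so the cutoff creates no jump.
    let C : X → Prop := fun v => ∃ p : G.toSimpleGraph.Walk v z, y ∉ p.support
    have hC : ∀ a b, G.toSimpleGraph.Adj a b → C a → ¬ C b → b = y := by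
      rintro a b hab ⟨p, hpa⟩ hb
      by_contra hby
      refine hb ⟨.cons hab.symm p, ?_⟩
      rw [SimpleGraph.Walk.support_cons, List.mem_cons, not_or]
      exact ⟨Ne.symm hby, hpa⟩
    have hCx : ¬ C x := fun ⟨p, hpx⟩ => hpx (hp p)
    have hCy : ¬ C y := fun ⟨p, hpy⟩ => hpy p.start_mem_support
    by_cases hzy : z = y
    · rw [hzy]
    have hCz : C z := ⟨.nil, by simpa using Ne.symm hzy⟩
    have key := H.eq_of_sq_le (k := fun v => if C v then h v - h y else 0) (fun a b hab => ?_)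
      (by simp only [if_neg hCx, if_neg hCy]) hz
    · simp only [if_pos hCz, if_neg hCy] at key
      linarith
    · by_cases ha : C a <;> by_cases hb : C b
      · simp only [if_pos ha, if_pos hb]
        exact le_of_eq (by ring)
      · simp only [if_pos ha, hC a b hab ha hb, if_neg hCy]
        exact le_of_eq (by ring)
      · simp only [if_pos hb, hC b a hab.symm hb ha, if_neg hCy]
        exact le_of_eq (by ring)
      · simp only [if_neg ha, if_neg hb]
        exact le_of_eq (by ring)

end IsDipole

lemma resistance_ne_top {x y : X} (h : G.toSimpleGraph.Reachable x y) :
    G.resistance x y ≠ ⊤ := by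
  obtain ⟨g, u, H⟩ := G.exists_isDipole h
  rw [H.resistance_eq]
  exact ENNReal.ofReal_ne_top

/-- The indicator of the component of `x` has zero energy but separates `x` from `y`. -/
lemma resistance_eq_top {x y : X} (h : ¬ G.toSimpleGraph.Reachable x y) :
    G.resistance x y = ⊤ := by
  classical
  rw [eq_top_iff]
  refine le_iSup_of_le (fun v => if G.toSimpleGraph.Reachable x v then 1 else 0) ?_
  have hE : G.energy (fun v => if G.toSimpleGraph.Reachable x v then 1 else 0) = 0 := by
    rw [energy_eq_tsum, ENNReal.tsum_eq_zero]
    intro e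
    by_cases hadj : G.toSimpleGraph.Adj e.1 e.2
    · have : G.toSimpleGraph.Reachable x e.1 ↔ G.toSimpleGraph.Reachable x e.2 :=
        ⟨fun hr => hr.trans hadj.reachable, fun hr => hr.trans hadj.symm.reachable⟩
      simp [grad, this]
    · simp [G.grad_eq_zero_of_not_adj _ hadj]
  rw [hE]
  simp [h]

lemma resistance_eq_add_iff {x y z : X} (hxy : G.toSimpleGraph.Reachable x y)
    (hyz : G.toSimpleGraph.Reachable y z) :
    G.resistance x z = G.resistance x y + G.resistance y z ↔
      ∀ p : G.toSimpleGraph.Walk x z, y ∈ p.support := by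
  obtain ⟨h, u, H⟩ := G.exists_isDipole hxy
  obtain ⟨g, w, H'⟩ := G.exists_isDipole hyz
  rw [← H.eq_iff_forall_walk hyz.symm, (H.add H').resistance_eq, H.resistance_eq,
    H'.resistance_eq, ← ENNReal.ofReal_add (sub_nonneg.2 H.le) (sub_nonneg.2 H'.le),
    ENNReal.ofReal_eq_ofReal_iff (sub_nonneg.2 (H.add H').le)
      (add_nonneg (sub_nonneg.2 H.le) (sub_nonneg.2 H'.le))]
  have h1 := H.inner_eq w g H'.coe_eq
  have h2 := H'.inner_eq u h H.coe_eq
  rw [real_inner_comm, h1] at h2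
  simp only [Pi.add_apply]
  constructor <;> intro <;> linarith

end GraphOver

theorem proposition3p2 {X : Type*} [Countable X] (G : GraphOver X) (x y z : X) :
    G.resistance x z = G.resistance x y + G.resistance y z ↔
      ∀ p : G.toSimpleGraph.Path x z, y ∈ (p : G.toSimpleGraph.Walk x z).support := by
  classical
  have hwalk : (∀ p : G.toSimpleGraph.Path x z, y ∈ (p : G.toSimpleGraph.Walk x z).support) ↔
      ∀ p : G.toSimpleGraph.Walk x z, y ∈ p.support :=
    ⟨fun h p => p.support_bypass_subset_support (h ⟨p.bypass, p.bypass_isPath⟩), fun h p => h p⟩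
  rw [hwalk]
  by_cases hxy : G.toSimpleGraph.Reachable x y
  · by_cases hyz : G.toSimpleGraph.Reachable y z
    · exact G.resistance_eq_add_iff hxy hyz
    · have hxz : ¬ G.toSimpleGraph.Reachable x z := fun h => hyz (hxy.symm.trans h)
      rw [G.resistance_eq_top hxz, G.resistance_eq_top hyz, add_top]
      exact iff_of_true rfl fun p => absurd p.reachable hxz
  · rw [G.resistance_eq_top hxy, top_add]
    by_cases hxz : G.toSimpleGraph.Reachable x z
    · refine iff_of_false (G.resistance_ne_top hxz) fun h => ?_
      obtain ⟨p⟩ := hxz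
      exact hxy ⟨p.takeUntil y (h p)⟩
    · exact iff_of_true (G.resistance_eq_top hxz) fun p => absurd p.reachable hxz
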